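/- Let $\mathbb D=\{z\in\mathbb C:|z|<1\}$ and, for a function $f$ analytic in $\mathbb D$, let $$\|f\|=\left\{\frac1\pi\int_{\mathbb D}|f(z)|^2\,dA(z)\right\}^{1/2}\in[0,\infty]$$ be its Bergman space ($A^2$) norm, where $dA$ is Lebesgue area measure. Then the Korenblum maximum principle holds with the constant $c=0.21$: whenever $f$ and $g$ are analytic in $\mathbb D$ and satisfy $|f(z)|\le|g(z)|$ for $0.21<|z|<1$, we have $\|f\|\le\|g\|$ (where $\|g\|=\infty$ is allowed; in particular, if $\|g\|<\infty$, then $\|f\|<\infty$). -/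

import Mathlib

open MeasureTheory
open scoped ENNReal

/-- The norm of the Bergman space `A²` of the unit disk,
`‖f‖ = ((1/π) ∫_{|z|<1} |f(z)|² dA(z))^{1/2}`, with `dA` Lebesgue area measure on `ℂ`,
taken as an extended nonnegative real: it equals `∞` when the integral diverges, so an
analytic `f` is in `A²` exactly when `bergmanNorm f < ∞`. -/
noncomputable def bergmanNorm (f : ℂ → ℂ) : ℝ≥0∞ :=
  (ENNReal.ofReal (1 / Real.pi) * ∫⁻ z in Metric.ball (0 : ℂ) 1, ‖f z‖ₑ ^ 2) ^ (1 / 2 : ℝ)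

open Complex Metric Set Filter Topology

/-! Write `c = 0.21` and `f = ω g` with `|ω| ≤ 1` on the annulus `c < |z| < 1`; scaling `f` by `t <
1` makes this strict. For `|a| < 1`, passing from `(f, g)` to `(f - a g, g - conj a f)` multiplies
`|g|² - |f|²` by the constant `1 - |a|²` and replaces `ω` by its Möbius image. Hence `ω` may be
normalised by disk automorphisms, and two of them produce a ratio `ψ` with `ψ(-√c) = -ψ(√c)`.

A holomorphic map from the annulus to the disk contracts hyperbolic distance, and half of the middle
circle `|z| = √c` has hyperbolic length `π² / log (1/c)`. A point `z` of that circle splits such a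
half, so the distances from `ψ(z)` to the two opposite values sum to at most this length, and `ψ(z)`
lies within half of it from `0` (`norm_le_of_antipodal`). Numerically `|ψ| ≤ 23/25` there, and the
maximum principle for `ψ^10 / z` gives `|ψ|^10 ≤ |z|` further out (`norm_pow_ten_le_norm`).

Now write `F` and `G` for the normalised pair. The excess of `|G|²` over `|F|²` for `√c < |z| < 1`
is at least `(|z|^(-1/5) - 1)|F|²`. As circular means of `|F|²` increase with the radius, this pays
for the whole integral of `|F|²` over `|z| ≤ c` (`inner_mass_le_outer_mass`, `lintegral_weight_le`).
-/

/-! ### Circular means and radial mass comparison -/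

/-- The integral of `|F|²` over the angular variable on the circle of radius `r`. -/
noncomputable def circleSq (F : ℂ → ℂ) (r : ℝ) : ℝ :=
  ∫ θ in (-Real.pi)..Real.pi, ‖F (r * exp (θ * I))‖ ^ 2

lemma norm_mul_exp_ofReal (z : ℂ) (θ : ℝ) : ‖z * exp (θ * I)‖ = ‖z‖ := by
  rw [norm_mul, norm_exp_ofReal_mul_I, mul_one]

lemma continuous_comp_rotation {F : ℂ → ℂ} (hF : ContinuousOn F (ball 0 1)) {z : ℂ} (hz : ‖z‖ < 1) :
    Continuous fun θ : ℝ => F (z * exp (θ * I)) := by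
  refine hF.comp_continuous (by fun_prop) fun θ => ?_
  rw [mem_ball_zero_iff, norm_mul_exp_ofReal]
  exact hz

lemma circleSq_norm {F : ℂ → ℂ} (z : ℂ) :
    ∫ θ in (-Real.pi)..Real.pi, ‖F (z * exp (θ * I))‖ ^ 2 = circleSq F ‖z‖ := by
  have hper : Function.Periodic (fun θ : ℝ => ‖F (‖z‖ * exp (θ * I))‖ ^ 2) (2 * Real.pi) := by
    intro θ
    have : exp (((θ + 2 * Real.pi : ℝ) : ℂ) * I) = exp (θ * I) := by
      push_cast
      rw [add_mul, exp_add, exp_two_pi_mul_I, mul_one]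
    simp only [this]
  have h1 : ∀ θ : ℝ, F (z * exp (θ * I)) = F (‖z‖ * exp (((θ + arg z : ℝ) : ℂ) * I)) := by
    intro θ
    congr 1
    nth_rewrite 1 [← norm_mul_exp_arg_mul_I z]
    push_cast
    rw [add_mul, exp_add]
    ring
  simp_rw [h1]
  rw [intervalIntegral.integral_comp_add_right (fun θ : ℝ => ‖F (‖z‖ * exp ((θ : ℂ) * I))‖ ^ 2)]
  have := hper.intervalIntegral_add_eq (-Real.pi + arg z) (-Real.pi)
  rw [show -Real.pi + arg z + 2 * Real.pi = Real.pi + arg z by ring,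
    show -Real.pi + 2 * Real.pi = Real.pi by ring] at this
  exact this

lemma differentiableOn_integral_rotation {F : ℂ → ℂ} (hF : DifferentiableOn ℂ F (ball 0 1))
    {k : ℝ → ℂ} (hk : Continuous k) :
    DifferentiableOn ℂ (fun z => ∫ θ in (-Real.pi)..Real.pi, F (z * exp (θ * I)) * k θ)
      (ball 0 1) := by
  intro z hz
  rw [mem_ball_zero_iff] at hz
  obtain ⟨R, hzR, hR⟩ := exists_between hz
  have hdF : ContinuousOn (deriv F) (ball 0 1) := (hF.deriv isOpen_ball).continuousOn
  obtain ⟨C, hC⟩ := (isCompact_closedBall (0 : ℂ) R).exists_bound_of_continuousOn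
    (hdF.mono (closedBall_subset_ball hR))
  have hs : ball (0 : ℂ) R ∈ 𝓝 z := isOpen_ball.mem_nhds (by simpa using hzR)
  have hlt : ∀ x ∈ ball (0 : ℂ) R, ‖x‖ < 1 := fun x hx => by
    rw [mem_ball_zero_iff] at hx; exact hx.trans hR
  have key := (intervalIntegral.hasDerivAt_integral_of_dominated_loc_of_deriv_le
    (μ := volume) (a := -Real.pi) (b := Real.pi) (𝕜 := ℂ)
    (F := fun z θ => F (z * exp (θ * I)) * k θ)
    (F' := fun z θ => deriv F (z * exp (θ * I)) * exp (θ * I) * k θ)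
    (bound := fun θ => C * ‖k θ‖) (x₀ := z) hs ?_ ?_ ?_ ?_ ?_ ?_).2
  · exact key.differentiableAt.differentiableWithinAt
  · filter_upwards [hs] with x hx
    exact ((continuous_comp_rotation hF.continuousOn (hlt x hx)).mul hk).aestronglyMeasurable
  · exact ((continuous_comp_rotation hF.continuousOn hz).mul hk).intervalIntegrable _ _
  · exact (((continuous_comp_rotation hdF hz).mul (by fun_prop)).mul hk).aestronglyMeasurable
  · refine Eventually.of_forall fun θ _ x hx => ?_
    rw [norm_mul, norm_mul, norm_exp_ofReal_mul_I, mul_one]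
    gcongr
    apply hC
    rw [mem_closedBall_zero_iff, norm_mul_exp_ofReal]
    exact (mem_ball_zero_iff.1 hx).le
  · exact (continuous_const.mul hk.norm).intervalIntegrable _ _
  · refine Eventually.of_forall fun θ _ x hx => ?_
    have hx' : x * exp (θ * I) ∈ ball (0 : ℂ) 1 := by
      rw [mem_ball_zero_iff, norm_mul_exp_ofReal]; exact hlt x hx
    have h1 := (hF.differentiableAt (isOpen_ball.mem_nhds hx')).hasDerivAt
    have h2 : HasDerivAt (fun x : ℂ => x * exp (θ * I)) (exp (θ * I)) x := by
      simpa using (hasDerivAt_id x).mul_const (exp (θ * I))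
    exact (h1.comp x h2).mul_const (k θ)

/-- Correlating `F` with its own values on the circle of radius `s` gives a holomorphic `Φ` that
equals the mean at `s`. The maximum principle on `|z| < r` bounds it by values on `|z| = r`, so no
power series is needed. -/
theorem circleSq_mono {F : ℂ → ℂ} (hF : DifferentiableOn ℂ F (ball 0 1)) {s r : ℝ} (hs : 0 ≤ s)
    (hsr : s < r) (hr : r < 1) : circleSq F s ≤ circleSq F r := by
  have hs1 : ‖(s : ℂ)‖ < 1 := by rw [norm_real, Real.norm_of_nonneg hs]; linarith
  set k : ℝ → ℂ := fun θ => (starRingEnd ℂ) (F (s * exp (θ * I))) with hk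
  have hFc := hF.continuousOn
  have hkc : Continuous k := continuous_conj.comp (continuous_comp_rotation hFc hs1)
  set Φ : ℂ → ℂ := fun z => ∫ θ in (-Real.pi)..Real.pi, F (z * exp (θ * I)) * k θ with hΦ
  have hd : DifferentiableOn ℂ Φ (ball 0 1) := differentiableOn_integral_rotation hF hkc
  have hΦs : Φ s = (circleSq F s : ℝ) := by
    rw [hΦ, circleSq, ← intervalIntegral.integral_ofReal]
    refine intervalIntegral.integral_congr fun θ _ => ?_
    simp only [hk, mul_conj, normSq_eq_norm_sq]
  -- The bound `xy ≤ (x² + y²)/2` replaces Cauchy–Schwarz; the half of `circleSq F s` is absorbed on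
  -- the left at the end.
  have hb : ∀ z ∈ frontier (ball (0 : ℂ) r), ‖Φ z‖ ≤ (circleSq F r + circleSq F s) / 2 := by
    intro z hz
    have hzr : ‖z‖ = r := by
      have := frontier_ball_subset_sphere hz
      simpa using this
    have hz1 : ‖z‖ < 1 := by rw [hzr]; exact hr
    have i1 : IntervalIntegrable (fun θ : ℝ => ‖F (z * exp (θ * I))‖ ^ 2) volume
        (-Real.pi) Real.pi :=
      ((continuous_comp_rotation hFc hz1).norm.pow 2).intervalIntegrable _ _
    have i2 : IntervalIntegrable (fun θ : ℝ => ‖F (s * exp (θ * I))‖ ^ 2) volume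
        (-Real.pi) Real.pi :=
      ((continuous_comp_rotation hFc hs1).norm.pow 2).intervalIntegrable _ _
    have e : (circleSq F r + circleSq F s) / 2 = ∫ θ in (-Real.pi)..Real.pi,
        (‖F (z * exp (θ * I))‖ ^ 2 + ‖F (s * exp (θ * I))‖ ^ 2) / 2 := by
      rw [intervalIntegral.integral_div, intervalIntegral.integral_add i1 i2, circleSq_norm, hzr]
      rfl
    rw [e]
    refine intervalIntegral.norm_integral_le_of_norm_le (by linarith [Real.pi_pos])
      (Eventually.of_forall fun θ _ => ?_) ((i1.add i2).div_const 2)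
    simp only [hk, norm_mul, RCLike.norm_conj]
    nlinarith [sq_nonneg (‖F (z * exp (θ * I))‖ - ‖F (s * exp (θ * I))‖)]
  have hdc : DiffContOnCl ℂ Φ (ball 0 r) := by
    apply DifferentiableOn.diffContOnCl
    exact hd.mono (closure_ball_subset_closedBall.trans (closedBall_subset_ball hr))
  have hmem : (s : ℂ) ∈ closure (ball (0 : ℂ) r) := by
    apply subset_closure
    rw [mem_ball_zero_iff, norm_real, Real.norm_of_nonneg hs]; exact hsr
  have := norm_le_of_forall_mem_frontier_norm_le isBounded_ball hdc hb hmem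
  rw [hΦs, norm_real] at this
  have h2 := (le_abs_self (circleSq F s)).trans this
  linarith

lemma lintegral_circle_mono {F : ℂ → ℂ} (hF : DifferentiableOn ℂ F (ball 0 1)) {s r : ℝ}
    (hs : 0 ≤ s) (hsr : s < r) (hr : r < 1) :
    ∫⁻ θ in Ioo (-Real.pi) Real.pi, ‖F (s * exp ((θ : ℝ) * I))‖ₑ ^ 2 ≤
      ∫⁻ θ in Ioo (-Real.pi) Real.pi, ‖F (r * exp ((θ : ℝ) * I))‖ₑ ^ 2 := by
  have key : ∀ x : ℝ, 0 ≤ x → x < 1 →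
      ∫⁻ θ in Ioo (-Real.pi) Real.pi, ‖F (x * exp ((θ : ℝ) * I))‖ₑ ^ 2 =
        ENNReal.ofReal (circleSq F x) := by
    intro x hx hx1
    have hn : ‖(x : ℂ)‖ < 1 := by rw [norm_real, Real.norm_of_nonneg hx]; exact hx1
    have hc := ((continuous_comp_rotation hF.continuousOn hn).norm.pow 2)
    rw [circleSq, intervalIntegral.integral_of_le (by linarith [Real.pi_pos]),
      ofReal_integral_eq_lintegral_ofReal, setLIntegral_congr Ioo_ae_eq_Ioc]
    · refine lintegral_congr fun θ => ?_
      rw [ENNReal.ofReal_pow (norm_nonneg _), ofReal_norm]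
    · exact (hc.integrableOn_Icc).mono_set Ioc_subset_Icc_self
    · exact Eventually.of_forall fun θ => by positivity
  rw [key s hs (hsr.trans hr), key r (hs.trans hsr.le) hr]
  exact ENNReal.ofReal_le_ofReal (circleSq_mono hF hs hsr hr)

lemma lintegral_radial_mul {W : ℝ → ℝ≥0∞} (hW : Measurable W) {h : ℂ → ℝ≥0∞} (hh : Measurable h) :
    ∫⁻ z, W ‖z‖ * h z = ∫⁻ r in Ioi (0 : ℝ), ENNReal.ofReal r * W r *
      ∫⁻ θ in Ioo (-Real.pi) Real.pi, h (r * exp ((θ : ℝ) * I)) := by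
  rw [← Complex.lintegral_comp_polarCoord_symm, polarCoord_target, Measure.volume_eq_prod,
    ← Measure.prod_restrict, lintegral_prod]
  · refine setLIntegral_congr_fun measurableSet_Ioi fun r hr => ?_
    have hm : Measurable fun θ : ℝ => h (r * exp ((θ : ℝ) * I)) :=
      hh.comp (by fun_prop)
    simp only
    rw [← lintegral_const_mul _ hm]
    refine lintegral_congr fun θ => ?_
    rw [Complex.norm_polarCoord_symm, Complex.polarCoord_symm_apply, abs_of_pos hr, smul_eq_mul,
      exp_mul_I, mul_assoc]
    push_cast
    rfl
  · apply Measurable.aemeasurable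
    have : Measurable fun p : ℝ × ℝ => Complex.polarCoord.symm p := by
      simp only [Complex.polarCoord_symm_apply]
      fun_prop
    have h1 : Measurable fun p : ℝ × ℝ => W ‖Complex.polarCoord.symm p‖ :=
      hW.comp this.norm
    exact (ENNReal.measurable_ofReal.comp measurable_fst).mul (h1.mul (hh.comp this))

/-- The circular mean at `r₀` separates the two sides: it dominates all means inside and is
dominated by all means outside. Only the radial masses in `hle` remain to be compared. -/
lemma inner_mass_le_outer_mass {c r₀ : ℝ} (hc : 0 < c) (hcr : c < r₀) (hr : r₀ < 1)
    (W : ℝ → ℝ≥0∞) (hW : Measurable W)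
    (hle : ∫⁻ r in Ioc 0 c, ENNReal.ofReal r ≤ ∫⁻ r in Ioo r₀ 1, ENNReal.ofReal r * W r)
    {F : ℂ → ℂ} (hF : DifferentiableOn ℂ F (ball 0 1)) :
    ∫⁻ z in {z : ℂ | ‖z‖ ≤ c}, ‖F z‖ₑ ^ 2 ≤
      ∫⁻ z in {z : ℂ | r₀ < ‖z‖ ∧ ‖z‖ < 1}, W ‖z‖ * ‖F z‖ₑ ^ 2 := by
  set h : ℂ → ℝ≥0∞ := (ball (0 : ℂ) 1).indicator fun z => ‖F z‖ₑ ^ 2 with hh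
  have hmeas : Measurable h := by
    classical
    have : ContinuousOn (fun z => ‖F z‖ₑ ^ 2) (ball 0 1) :=
      (ENNReal.continuous_pow 2).comp_continuousOn hF.continuousOn.enorm
    have h0 := this.measurable_piecewise (g := 0) continuousOn_const
      measurableSet_ball
    rwa [piecewise_eq_indicator] at h0
  have hin : ∀ z : ℂ, ‖z‖ < 1 → h z = ‖F z‖ₑ ^ 2 := fun z hz =>
    indicator_of_mem (by simpa using hz) _
  set N : ℝ → ℝ≥0∞ := fun r => ∫⁻ θ in Ioo (-Real.pi) Real.pi, h (r * exp ((θ : ℝ) * I)) with hN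
  have hNe : ∀ x : ℝ, 0 ≤ x → x < 1 →
      N x = ∫⁻ θ in Ioo (-Real.pi) Real.pi, ‖F (x * exp ((θ : ℝ) * I))‖ₑ ^ 2 := by
    intro x hx hx1
    refine lintegral_congr fun θ => hin _ ?_
    rw [norm_mul_exp_ofReal, norm_real, Real.norm_of_nonneg hx]; exact hx1
  have hmono : ∀ s r : ℝ, 0 ≤ s → s < r → r < 1 → N s ≤ N r := by
    intro s r hs hsr hr1
    rw [hNe s hs (hsr.trans hr1), hNe r (hs.trans hsr.le) hr1]
    exact lintegral_circle_mono hF hs hsr hr1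
  have hr0 : 0 < r₀ := hc.trans hcr
  have e1 : ∫⁻ z in {z : ℂ | ‖z‖ ≤ c}, ‖F z‖ₑ ^ 2 =
      ∫⁻ z, (Iic c).indicator (fun _ => (1 : ℝ≥0∞)) ‖z‖ * h z := by
    rw [← lintegral_indicator (measurableSet_le measurable_norm measurable_const)]
    refine lintegral_congr fun z => ?_
    by_cases hz : ‖z‖ ≤ c
    · rw [indicator_of_mem (by exact hz), indicator_of_mem (by exact hz), one_mul,
        hin z (hz.trans_lt (hcr.trans hr))]
    · rw [indicator_of_notMem (by exact hz), indicator_of_notMem (by exact hz), zero_mul]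
  have e2 : ∫⁻ z in {z : ℂ | r₀ < ‖z‖ ∧ ‖z‖ < 1}, W ‖z‖ * ‖F z‖ₑ ^ 2 =
      ∫⁻ z, (Ioo r₀ 1).indicator W ‖z‖ * h z := by
    have hms : MeasurableSet {z : ℂ | r₀ < ‖z‖ ∧ ‖z‖ < 1} :=
      (measurableSet_lt measurable_const measurable_norm).inter
        (measurableSet_lt measurable_norm measurable_const)
    rw [← lintegral_indicator hms]
    refine lintegral_congr fun z => ?_
    by_cases hz : r₀ < ‖z‖ ∧ ‖z‖ < 1
    · rw [indicator_of_mem (by exact hz), indicator_of_mem (by exact hz), hin z hz.2]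
    · rw [indicator_of_notMem (by exact hz), indicator_of_notMem (by exact hz), zero_mul]
  rw [e1, e2, lintegral_radial_mul (measurable_const.indicator measurableSet_Iic) hmeas,
    lintegral_radial_mul (hW.indicator measurableSet_Ioo) hmeas]
  calc _ ≤ ∫⁻ r in Ioi (0 : ℝ), (Ioc 0 c).indicator ENNReal.ofReal r * N r₀ := by
        refine setLIntegral_mono' measurableSet_Ioi fun r hr => ?_
        by_cases hrc : r ≤ c
        · rw [indicator_of_mem (by exact hrc), indicator_of_mem (by exact ⟨hr, hrc⟩), mul_one]
          gcongr
          exact hmono r r₀ (le_of_lt hr) (hrc.trans_lt hcr) ‹_›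
        · rw [indicator_of_notMem (by exact hrc)]
          simp
    _ = (∫⁻ r in Ioc 0 c, ENNReal.ofReal r) * N r₀ := by
        rw [lintegral_mul_const _ (ENNReal.measurable_ofReal.indicator measurableSet_Ioc),
          setLIntegral_indicator measurableSet_Ioc,
          inter_eq_self_of_subset_left Ioc_subset_Ioi_self]
    _ ≤ (∫⁻ r in Ioo r₀ 1, ENNReal.ofReal r * W r) * N r₀ := by gcongr
    _ = ∫⁻ r in Ioi (0 : ℝ), (Ioo r₀ 1).indicator (fun r => ENNReal.ofReal r * W r) r * N r₀ := by
        have hm : Measurable fun r => ENNReal.ofReal r * W r := ENNReal.measurable_ofReal.mul hW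
        rw [lintegral_mul_const _ (hm.indicator measurableSet_Ioo),
          setLIntegral_indicator measurableSet_Ioo,
          inter_eq_self_of_subset_left (show Ioo r₀ 1 ⊆ Ioi 0 from fun x hx => hr0.trans hx.1)]
    _ ≤ _ := by
        refine setLIntegral_mono' measurableSet_Ioi fun r _ => ?_
        by_cases hrc : r ∈ Ioo r₀ 1
        · rw [indicator_of_mem hrc, indicator_of_mem hrc]
          gcongr
          exact hmono r₀ r hr0.le hrc.1 hrc.2
        · rw [indicator_of_notMem hrc]
          simp

/-- The left side is `0.21²/2 = 0.02205`; the right side is `(1 - 0.21^(9/10))/1.8 - 0.79/2`, about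
`0.0239`. -/
lemma lintegral_weight_le :
    ∫⁻ r in Ioc (0 : ℝ) 0.21, ENNReal.ofReal r ≤
      ∫⁻ r in Ioo (√0.21 : ℝ) 1, ENNReal.ofReal r * ENNReal.ofReal (r ^ (-(1 / 5) : ℝ) - 1) := by
  have hs0 : (0 : ℝ) < √0.21 := by positivity
  have hsq : (√0.21 : ℝ) ^ 2 = 0.21 := Real.sq_sqrt (by norm_num)
  have hs1 : (√0.21 : ℝ) < 1 := by nlinarith
  have hL : ∫⁻ r in Ioc (0 : ℝ) 0.21, ENNReal.ofReal r = ENNReal.ofReal (0.21 ^ 2 / 2) := by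
    rw [← ofReal_integral_eq_lintegral_ofReal, ← intervalIntegral.integral_of_le (by norm_num),
      integral_id]
    · norm_num
    · exact (continuous_id.integrableOn_Icc).mono_set Ioc_subset_Icc_self
    · exact (ae_restrict_mem measurableSet_Ioc).mono fun x hx => hx.1.le
  have hR : ∫⁻ r in Ioo (√0.21 : ℝ) 1,
      ENNReal.ofReal r * ENNReal.ofReal (r ^ (-(1 / 5) : ℝ) - 1) =
      ENNReal.ofReal (∫ r in (√0.21 : ℝ)..1, (r ^ (4 / 5 : ℝ) - r)) := by
    rw [setLIntegral_congr Ioo_ae_eq_Ioc, intervalIntegral.integral_of_le hs1.le,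
      ofReal_integral_eq_lintegral_ofReal]
    · refine setLIntegral_congr_fun measurableSet_Ioc fun r hr => ?_
      have hr0 : 0 < r := hs0.trans hr.1
      rw [← ENNReal.ofReal_mul hr0.le, mul_sub, mul_one]
      congr 2
      nth_rewrite 1 [← Real.rpow_one r]
      rw [← Real.rpow_add hr0]
      norm_num
    · refine IntegrableOn.mono_set (ContinuousOn.integrableOn_Icc ?_) Ioc_subset_Icc_self
      refine ContinuousOn.sub (fun x _ => ?_) continuousOn_id
      exact (Real.continuousAt_rpow_const _ _ (Or.inr (by norm_num))).continuousWithinAt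
    · refine (ae_restrict_mem measurableSet_Ioc).mono fun x hx => ?_
      have hx0 : 0 < x := hs0.trans hx.1
      have := Real.rpow_le_rpow_of_exponent_ge hx0 hx.2 (show (4 / 5 : ℝ) ≤ 1 by norm_num)
      rw [Real.rpow_one] at this
      exact sub_nonneg.2 this
  rw [hL, hR]
  apply ENNReal.ofReal_le_ofReal
  rw [intervalIntegral.integral_sub, integral_rpow (Or.inl (by norm_num)), integral_id, hsq]
  · have hp : (√0.21 : ℝ) ^ (4 / 5 + 1 : ℝ) ≤ 0.246 := by
      refine le_of_pow_le_pow_left₀ (n := 10) (by norm_num) (by norm_num) ?_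
      rw [← Real.rpow_natCast, ← Real.rpow_mul hs0.le]
      have : ((4 / 5 + 1 : ℝ) * ((10 : ℕ) : ℝ)) = ((18 : ℕ) : ℝ) := by norm_num
      rw [this, Real.rpow_natCast, show 18 = 2 * 9 by norm_num, pow_mul, hsq]
      norm_num
    rw [Real.one_rpow]
    norm_num at hp ⊢
    linarith
  · exact intervalIntegral.intervalIntegrable_rpow' (by norm_num)
  · exact continuous_id.intervalIntegrable _ _

/-! ### Hyperbolic geometry of the disk -/

open scoped ComplexConjugate

lemma one_sub_conj_mul_ne_zero {a b : ℂ} (ha : ‖a‖ < 1) (hb : ‖b‖ ≤ 1) : 1 - conj a * b ≠ 0 := by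
  intro h
  have h1 : ‖conj a * b‖ = 1 := by rw [← sub_eq_zero.1 h]; simp
  rw [norm_mul, RCLike.norm_conj] at h1
  nlinarith [norm_nonneg a, norm_nonneg b]

lemma norm_sq_one_sub_conj_mul_sub (a b : ℂ) :
    ‖1 - conj a * b‖ ^ 2 - ‖b - a‖ ^ 2 = (1 - ‖a‖ ^ 2) * (1 - ‖b‖ ^ 2) := by
  simp only [← normSq_eq_norm_sq, normSq_apply, sub_re, sub_im, mul_re, mul_im, conj_re, conj_im,
    one_re, one_im]
  ring

lemma norm_mobius_lt_one {a b : ℂ} (ha : ‖a‖ < 1) (hb : ‖b‖ < 1) :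
    ‖(b - a) / (1 - conj a * b)‖ < 1 := by
  have hne := one_sub_conj_mul_ne_zero ha hb.le
  rw [norm_div, div_lt_one (norm_pos_iff.2 hne)]
  have := norm_sq_one_sub_conj_mul_sub a b
  have h2 : 0 < (1 - ‖a‖ ^ 2) * (1 - ‖b‖ ^ 2) := by
    apply mul_pos <;> nlinarith [norm_nonneg a, norm_nonneg b]
  exact lt_of_pow_lt_pow_left₀ 2 (norm_nonneg _) (by linarith)

/-- The Schwarz–Pick inequality at the centre of the disk. -/
lemma schwarzPick_zero {h : ℂ → ℂ} (hd : DifferentiableOn ℂ h (ball 0 1))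
    (hm : ∀ w ∈ ball (0 : ℂ) 1, ‖h w‖ < 1) {w : ℂ} (hw : ‖w‖ < 1) :
    ‖h w - h 0‖ ≤ ‖w‖ * ‖1 - conj (h 0) * h w‖ := by
  have h0 := hm 0 (by simp)
  have hw' : w ∈ ball (0 : ℂ) 1 := by simpa using hw
  have := norm_le_norm_of_mapsTo_ball (f := fun w => (h w - h 0) / (1 - conj (h 0) * h w))
    (R := 1) (z := w) ?_ ?_ (by simp) hw
  · rwa [norm_div, div_le_iff₀ (norm_pos_iff.2 (one_sub_conj_mul_ne_zero h0 (hm w hw').le))] at this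
  · exact (hd.sub_const _).div ((hd.const_mul _).const_sub _)
      fun x hx => one_sub_conj_mul_ne_zero h0 (hm x hx).le
  · intro x hx
    rw [mem_closedBall_zero_iff]
    exact (norm_mobius_lt_one h0 (hm x hx)).le

/-- The algebra behind the midpoint estimate. With `P = √(E₁E₂)`, multiplying `h₁` and `h₂` bounds
`AB` above in terms of `TU`, and `h₃` then gives `V/U ≤ (P² + 1)/(2P) = cosh (log P)`, which
increases for `P ≥ 1`. In the application `V/U` is the hyperbolic cosine of the distance to the
origin. -/
lemma mul_le_mul_of_pseudoDist_bounds {A B T U V E₁ E₂ s : ℝ} (hT : 0 < T) (hU : 0 < U)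
    (hA : 0 ≤ A) (hB : 0 ≤ B) (hE₁ : 1 ≤ E₁) (hE₂ : 1 ≤ E₂)
    (h₁ : (1 - ((E₁ - 1) / (E₁ + 1)) ^ 2) * A ^ 2 ≤ T * U)
    (h₂ : (1 - ((E₂ - 1) / (E₂ + 1)) ^ 2) * B ^ 2 ≤ T * U)
    (h₃ : T * V ≤ (1 + (E₁ - 1) / (E₁ + 1) * ((E₂ - 1) / (E₂ + 1))) * (A * B))
    (hs : 0 < s) (hE : E₁ * E₂ ≤ s ^ 2) : 2 * s * V ≤ (s ^ 2 + 1) * U := by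
  have hE1 : 0 < E₁ := by linarith
  have hE2 : 0 < E₂ := by linarith
  have ea : 1 - ((E₁ - 1) / (E₁ + 1)) ^ 2 = 4 * E₁ / (E₁ + 1) ^ 2 := by field_simp; ring
  have eb : 1 - ((E₂ - 1) / (E₂ + 1)) ^ 2 = 4 * E₂ / (E₂ + 1) ^ 2 := by field_simp; ring
  have eab : 1 + (E₁ - 1) / (E₁ + 1) * ((E₂ - 1) / (E₂ + 1)) =
      2 * (E₁ * E₂ + 1) / ((E₁ + 1) * (E₂ + 1)) := by field_simp; ring
  rw [ea] at h₁
  rw [eb] at h₂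
  rw [eab] at h₃
  obtain ⟨P, hP, hPE⟩ : ∃ P : ℝ, 1 ≤ P ∧ P ^ 2 = E₁ * E₂ :=
    ⟨√(E₁ * E₂), Real.one_le_sqrt.2 (by nlinarith), Real.sq_sqrt (by positivity)⟩
  have hPs : P ≤ s := le_of_pow_le_pow_left₀ two_ne_zero hs.le (by rw [hPE]; exact hE)
  obtain ⟨D, hD⟩ : ∃ D, D = A * B / ((E₁ + 1) * (E₂ + 1)) := ⟨_, rfl⟩
  have hDn : 0 ≤ D := by rw [hD]; positivity
  have m1 : T * V ≤ 2 * (P ^ 2 + 1) * D := by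
    rw [hPE, hD]
    calc T * V ≤ _ := h₃
      _ = _ := by ring
  have m2 : 4 * P * D ≤ T * U := by
    refine le_of_pow_le_pow_left₀ two_ne_zero (by positivity) ?_
    have := mul_le_mul h₁ h₂ (by positivity) (by positivity)
    calc (4 * P * D) ^ 2 = 16 * P ^ 2 * D ^ 2 := by ring
      _ = 4 * E₁ / (E₁ + 1) ^ 2 * A ^ 2 * (4 * E₂ / (E₂ + 1) ^ 2 * B ^ 2) := by
        rw [hPE, hD]
        simp only [div_eq_mul_inv, mul_inv, ← inv_pow]
        generalize (E₁ + 1)⁻¹ = x, (E₂ + 1)⁻¹ = y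
        ring
      _ ≤ _ := this
      _ = _ := by ring
  have m3 : 2 * P * V ≤ (P ^ 2 + 1) * U := by
    have i1 := mul_le_mul_of_nonneg_left m1 (show 0 ≤ 2 * P by positivity)
    have i2 := mul_le_mul_of_nonneg_left m2 (show 0 ≤ P ^ 2 + 1 by positivity)
    refine le_of_mul_le_mul_left ?_ hT
    calc T * (2 * P * V) = 2 * P * (T * V) := by ring
      _ ≤ _ := i1
      _ = (P ^ 2 + 1) * (4 * P * D) := by ring
      _ ≤ _ := i2
      _ = _ := by ring
  have m4 : s * (P ^ 2 + 1) ≤ P * (s ^ 2 + 1) := by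
    have : 0 ≤ (s - P) * (s * P - 1) := mul_nonneg (by linarith) (by nlinarith)
    linarith
  have i1 := mul_le_mul_of_nonneg_left m3 hs.le
  have i2 := mul_le_mul_of_nonneg_right m4 hU.le
  refine le_of_mul_le_mul_left ?_ (show 0 < P by linarith)
  calc P * (2 * s * V) = s * (2 * P * V) := by ring
    _ ≤ _ := i1
    _ = s * (P ^ 2 + 1) * U := by ring
    _ ≤ _ := i2
    _ = _ := by ring

/-- If a point of the unit disk has hyperbolic distances at most `log E₁` and `log E₂` from two
opposite points, then its distance from the origin is at most `(log E₁ + log E₂) / 2`. -/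
lemma norm_sq_le_of_pseudoDist_le {u t : ℂ} (hu : ‖u‖ < 1) (ht : ‖t‖ < 1) {E₁ E₂ : ℝ}
    (hE₁ : 1 ≤ E₁) (hE₂ : 1 ≤ E₂)
    (h₁ : ‖u - t‖ ≤ (E₁ - 1) / (E₁ + 1) * ‖1 - conj t * u‖)
    (h₂ : ‖u + t‖ ≤ (E₂ - 1) / (E₂ + 1) * ‖1 + conj t * u‖) {s : ℝ} (hs : 0 < s)
    (hE : E₁ * E₂ ≤ s ^ 2) :
    2 * s * (1 + ‖u‖ ^ 2) ≤ (s ^ 2 + 1) * (1 - ‖u‖ ^ 2) := by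
  set A := ‖1 - conj t * u‖ with hA
  set B := ‖1 + conj t * u‖ with hB
  set T := 1 - ‖t‖ ^ 2 with hT
  set U := 1 - ‖u‖ ^ 2 with hU
  set V := 1 + ‖u‖ ^ 2 with hV
  have hTp : 0 < T := by nlinarith [norm_nonneg t]
  have hUp : 0 < U := by nlinarith [norm_nonneg u]
  have hVp : 0 < V := by positivity
  have hAn : 0 ≤ A := norm_nonneg _
  have hBn : 0 ≤ B := norm_nonneg _
  have eA : A ^ 2 - ‖u - t‖ ^ 2 = T * U := norm_sq_one_sub_conj_mul_sub t u
  have eB : B ^ 2 - ‖u + t‖ ^ 2 = T * U := by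
    have := norm_sq_one_sub_conj_mul_sub (-t) u
    simpa [hB, hT, hU] using this
  set a := (E₁ - 1) / (E₁ + 1) with ha
  set b := (E₂ - 1) / (E₂ + 1) with hb
  have hane : 0 ≤ a := div_nonneg (by linarith) (by linarith)
  have hbne : 0 ≤ b := div_nonneg (by linarith) (by linarith)
  have k1 : (1 - a ^ 2) * A ^ 2 ≤ T * U := by
    have : ‖u - t‖ ^ 2 ≤ (a * A) ^ 2 := by gcongr
    nlinarith
  have k2 : (1 - b ^ 2) * B ^ 2 ≤ T * U := by
    have : ‖u + t‖ ^ 2 ≤ (b * B) ^ 2 := by gcongr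
    nlinarith
  have k3 : T * V ≤ (1 + a * b) * (A * B) := by
    -- An exact identity coupling the points `t` and `-t`; the triangle inequality then gives the
    -- bound by `A * B`.
    have e : ((T * V : ℝ) : ℂ) = (1 - conj (conj t * u)) * (1 + conj t * u)
        + conj (u - t) * (u + t) := by
      have e1 : ((‖t‖ ^ 2 : ℝ) : ℂ) = t * conj t := by rw [mul_conj, normSq_eq_norm_sq]
      have e2 : ((‖u‖ ^ 2 : ℝ) : ℂ) = u * conj u := by rw [mul_conj, normSq_eq_norm_sq]
      rw [hT, hV, ofReal_mul, ofReal_sub, ofReal_add, e1, e2]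
      simp only [map_mul, map_sub, conj_conj, ofReal_one]
      ring
    have e3 : T * V = ‖((T * V : ℝ) : ℂ)‖ := by
      rw [norm_real, Real.norm_of_nonneg (by positivity)]
    have e4 : ‖1 - conj (conj t * u)‖ = A := by
      rw [hA, ← RCLike.norm_conj (1 - conj t * u)]; simp
    rw [e3, e]
    refine (norm_add_le _ _).trans ?_
    rw [norm_mul, norm_mul, e4, RCLike.norm_conj]
    have : ‖u - t‖ * ‖u + t‖ ≤ (a * A) * (b * B) := by gcongr
    nlinarith
  exact mul_le_mul_of_pseudoDist_bounds hTp hUp hAn hBn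
    hE₁ hE₂ k1 k2 k3 hs hE

/-! ### Contraction from the annulus to the disk -/

/-- The Cayley map sends the disk to the right half-plane, and the principal logarithm sends that to
a strip of width `π`. -/
lemma differentiableOn_log_cayley :
    DifferentiableOn ℂ (fun w : ℂ => log ((1 + w) / (1 - w))) (ball 0 1) ∧
      ∀ w ∈ ball (0 : ℂ) 1, |(log ((1 + w) / (1 - w))).im| < Real.pi / 2 := by
  have hne : ∀ w ∈ ball (0 : ℂ) 1, 1 - w ≠ 0 := fun w hw h => by
    rw [mem_ball_zero_iff, ← sub_eq_zero.1 h] at hw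
    simp at hw
  have hre : ∀ w ∈ ball (0 : ℂ) 1, 0 < ((1 + w) / (1 - w)).re := fun w hw => by
    have hn : 0 < normSq (1 - w) := normSq_pos.2 (hne w hw)
    have : normSq w < 1 := by
      rw [mem_ball_zero_iff] at hw
      rw [normSq_eq_norm_sq]
      nlinarith [norm_nonneg w]
    rw [div_re, ← add_div]
    refine div_pos ?_ hn
    rw [normSq_apply] at this
    simp only [add_re, sub_re, one_re, add_im, sub_im, one_im]
    nlinarith
  constructor
  · refine DifferentiableOn.clog ?_ fun w hw => Or.inl (hre w hw)
    exact (differentiableOn_id.const_add _).div (differentiableOn_id.const_sub _) hne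
  · intro w hw
    rw [log_im]
    exact abs_arg_lt_pi_div_two_iff.2 (Or.inl (hre w hw))

/-- The open annulus with inner radius `c` and outer radius `1`. -/
def unitAnnulus (c : ℝ) : Set ℂ := {z | c < ‖z‖ ∧ ‖z‖ < 1}

lemma isOpen_unitAnnulus (c : ℝ) : IsOpen (unitAnnulus c) :=
  (isOpen_lt continuous_const continuous_norm).inter (isOpen_lt continuous_norm continuous_const)

/-- The Schwarz–Pick inequality along the middle circle of an annulus, from the universal cover. -/
lemma schwarzPick_middle_circle {c : ℝ} (hc : 0 < c) (hc1 : c < 1) {ψ : ℂ → ℂ}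
    (hd : DifferentiableOn ℂ ψ (unitAnnulus c)) (hb : ∀ z ∈ unitAnnulus c, ‖ψ z‖ < 1) {z : ℂ}
    (hz : ‖z‖ = √c) (Δ : ℝ) :
    ‖ψ (z * exp (Δ * I)) - ψ z‖ ≤
      (Real.exp (Real.pi * |Δ| / Real.log c⁻¹) - 1) / (Real.exp (Real.pi * |Δ| / Real.log c⁻¹) + 1)
        * ‖1 - conj (ψ z) * ψ (z * exp (Δ * I))‖ := by
  set L := Real.log c⁻¹ with hL
  have hLp : 0 < L := Real.log_pos ((one_lt_inv₀ hc).2 hc1)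
  have hsq : √c = Real.exp (-L / 2) := by
    rw [hL, Real.log_inv, neg_neg, Real.exp_half, Real.exp_log hc]
  have hcL : c = Real.exp (-L) := by rw [hL, Real.log_inv, neg_neg, Real.exp_log hc]
  obtain ⟨hlogd, hlogb⟩ := differentiableOn_log_cayley
  -- The covering of the annulus centred at `z`: the strip is rescaled to width `L`, the modulus of
  -- the annulus in logarithmic scale, then exponentiated after a quarter turn. The real diameter
  -- covers the middle circle.
  set p : ℂ → ℂ := fun w => z * exp (L / Real.pi * log ((1 + w) / (1 - w)) * I) with hp
  have hpd : DifferentiableOn ℂ p (ball 0 1) :=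
    ((((hlogd.const_mul _).mul_const _).cexp).const_mul _)
  have hpm : MapsTo p (ball 0 1) (unitAnnulus c) := by
    intro w hw
    have h1 := abs_lt.1 (hlogb w hw)
    have h2 : ‖p w‖ = Real.exp (-L / 2 - L / Real.pi * (log ((1 + w) / (1 - w))).im) := by
      rw [hp]
      simp only
      rw [norm_mul, hz, hsq, norm_exp, ← Real.exp_add, ← ofReal_div]
      congr 1
      rw [mul_I_re, im_ofReal_mul]
      ring
    have hk : 0 < L / Real.pi := div_pos hLp Real.pi_pos
    have hk2 : L / Real.pi * (Real.pi / 2) = L / 2 := by field_simp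
    have h3 := mul_lt_mul_of_pos_left h1.1 hk
    have h4 := mul_lt_mul_of_pos_left h1.2 hk
    rw [mul_neg, hk2] at h3
    rw [hk2] at h4
    constructor
    · rw [h2]
      nth_rewrite 1 [hcL]
      exact Real.exp_lt_exp.2 (by linarith)
    · rw [h2]
      rw [← Real.exp_zero]
      exact Real.exp_lt_exp.2 (by linarith)
  -- `x = tanh (πΔ / 2L)` is the point of the diameter lying over `z * exp (Δ * I)`.
  set x : ℝ := (Real.exp (Real.pi * Δ / L) - 1) / (Real.exp (Real.pi * Δ / L) + 1) with hx
  have hxabs : |x| = (Real.exp (Real.pi * |Δ| / L) - 1) / (Real.exp (Real.pi * |Δ| / L) + 1) := by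
    rcases le_total 0 Δ with h | h
    · rw [abs_of_nonneg h, abs_of_nonneg]
      exact div_nonneg (sub_nonneg.2 (Real.one_le_exp (by positivity))) (by positivity)
    · rw [abs_of_nonpos h, abs_of_nonpos]
      · rw [hx, mul_neg, neg_div, Real.exp_neg]
        field_simp
        ring
      · refine div_nonpos_of_nonpos_of_nonneg (sub_nonpos.2 (Real.exp_le_one_iff.2 ?_))
          (by positivity)
        exact div_nonpos_of_nonpos_of_nonneg
          (mul_nonpos_of_nonneg_of_nonpos Real.pi_pos.le h) hLp.le
  have hx1 : ‖(x : ℂ)‖ < 1 := by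
    rw [norm_real, Real.norm_eq_abs, hxabs, div_lt_one (by positivity)]
    linarith
  have hp0 : p 0 = z := by simp [hp]
  have hpx : p x = z * exp (Δ * I) := by
    have : (1 + (x : ℂ)) / (1 - x) = ((Real.exp (Real.pi * Δ / L) : ℝ) : ℂ) := by
      rw [← ofReal_one, ← ofReal_add, ← ofReal_sub, ← ofReal_div]
      congr 1
      rw [hx]
      field_simp
      ring
    rw [hp]
    simp only [this]
    rw [← ofReal_log (Real.exp_pos _).le, Real.log_exp]
    congr 3
    push_cast
    have : (L : ℂ) ≠ 0 := by exact_mod_cast hLp.ne'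
    have : (Real.pi : ℂ) ≠ 0 := by exact_mod_cast Real.pi_ne_zero
    field_simp
  have := schwarzPick_zero (h := ψ ∘ p) (hd.comp hpd hpm) (fun w hw => hb _ (hpm hw)) hx1
  simp only [Function.comp, hp0, hpx] at this
  rwa [norm_real, Real.norm_eq_abs, hxabs] at this

/-- The margin is small: `π²` is about `9.870`, against `2 * 3.165 * 1.56 = 9.8748`. The Taylor
bound for `exp` is applied to `1.56/8` and `3.165/15`, where it is sharp enough. -/
lemma exp_pi_sq_div_log_le : Real.exp (Real.pi ^ 2 / Real.log (0.21 : ℝ)⁻¹) ≤ 24 ^ 2 := by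
  have hb : ∀ x : ℝ, 0 ≤ x → x ≤ 1 → Real.exp x ≤ 1 + x + x ^ 2 / 2 + x ^ 3 / 6 + x ^ 4 * (5 / 96) := by
    intro x h0 h1
    have := Real.exp_bound' h0 h1 (n := 4) (by norm_num)
    norm_num [Finset.sum_range_succ, Nat.factorial] at this
    linarith
  have h1 : (1.56 : ℝ) ≤ Real.log (0.21 : ℝ)⁻¹ := by
    rw [Real.le_log_iff_exp_le (by norm_num)]
    have h := hb 0.195 (by norm_num) (by norm_num)
    calc Real.exp 1.56 = Real.exp 0.195 ^ 8 := by rw [← Real.exp_nat_mul]; norm_num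
      _ ≤ _ := pow_le_pow_left₀ (Real.exp_pos _).le h 8
      _ ≤ _ := by norm_num
  have h2 : (3.165 : ℝ) ≤ Real.log 24 := by
    rw [Real.le_log_iff_exp_le (by norm_num)]
    have h := hb 0.2110 (by norm_num) (by norm_num)
    calc Real.exp 3.165 = Real.exp 0.2110 ^ 15 := by rw [← Real.exp_nat_mul]; norm_num
      _ ≤ _ := pow_le_pow_left₀ (Real.exp_pos _).le h 15
      _ ≤ _ := by norm_num
  rw [← Real.le_log_iff_exp_le (by norm_num), Real.log_pow, div_le_iff₀ (by linarith)]
  have hpi := Real.pi_lt_d4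
  have : Real.pi ^ 2 ≤ 3.1416 ^ 2 := by gcongr
  push_cast
  nlinarith

lemma norm_le_of_antipodal {ψ : ℂ → ℂ} (hd : DifferentiableOn ℂ ψ (unitAnnulus 0.21))
    (hb : ∀ z ∈ unitAnnulus 0.21, ‖ψ z‖ < 1) (hodd : ψ (-(√0.21 : ℝ)) = -ψ (√0.21 : ℝ)) {z : ℂ}
    (hz : ‖z‖ = √0.21) : ‖ψ z‖ ≤ 23 / 25 := by
  have hs0 : (0 : ℝ) < √0.21 := by positivity
  have hsq : (√0.21 : ℝ) ^ 2 = 0.21 := Real.sq_sqrt (by norm_num)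
  have hr : ∀ w : ℂ, ‖w‖ = √0.21 → w ∈ unitAnnulus 0.21 := fun w hw => by
    constructor <;> rw [hw] <;> nlinarith
  have hn1 : ‖((√0.21 : ℝ) : ℂ)‖ = √0.21 := by rw [norm_real, Real.norm_of_nonneg hs0.le]
  have hn2 : ‖-((√0.21 : ℝ) : ℂ)‖ = √0.21 := by rw [norm_neg, hn1]
  have hL : 0 < Real.log (0.21 : ℝ)⁻¹ := Real.log_pos (by norm_num)
  have e1 : ((√0.21 : ℝ) : ℂ) * exp (arg z * I) = z := by
    rw [← hz]; exact norm_mul_exp_arg_mul_I z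
  -- `Δ` is the signed angle from `-√0.21` to `z`, taken along the half circle through `z`, so the
  -- two arcs add up to `π`.
  obtain ⟨Δ, hΔ, hΔπ⟩ : ∃ Δ : ℝ, -((√0.21 : ℝ) : ℂ) * exp (Δ * I) = z ∧
      |arg z| + |Δ| = Real.pi := by
    rcases le_total 0 (arg z) with h | h
    · refine ⟨arg z - Real.pi, ?_, ?_⟩
      · push_cast
        rw [sub_mul, exp_sub, exp_pi_mul_I, div_neg, div_one, neg_mul_neg, e1]
      · rw [abs_of_nonneg h, abs_of_nonpos (by linarith [arg_le_pi z])]; ring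
    · refine ⟨arg z + Real.pi, ?_, ?_⟩
      · push_cast
        rw [add_mul, exp_add, exp_pi_mul_I, mul_neg_one, neg_mul_neg, e1]
      · rw [abs_of_nonpos h, abs_of_nonneg (by linarith [neg_pi_lt_arg z])]; ring
  have h1 := schwarzPick_middle_circle (by norm_num) (by norm_num) hd hb hn1 (arg z)
  have h2 := schwarzPick_middle_circle (by norm_num) (by norm_num) hd hb hn2 Δ
  rw [e1] at h1
  rw [hΔ, hodd, map_neg, sub_neg_eq_add, neg_mul, sub_neg_eq_add] at h2
  have key := norm_sq_le_of_pseudoDist_le (hb z (hr z hz)) (hb _ (hr _ hn1))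
    (Real.one_le_exp (by positivity)) (Real.one_le_exp (by positivity)) h1 h2
    (s := 24) (by norm_num) (by
      rw [← Real.exp_add, ← add_div, ← mul_add, hΔπ, ← pow_two]
      exact exp_pi_sq_div_log_le)
  -- `23/25 = (24 - 1)/(24 + 1)` is the radius at hyperbolic distance `log 24` from the origin.
  exact le_of_pow_le_pow_left₀ two_ne_zero (by norm_num) (by nlinarith)

/-- Maximum principle for `ψ^10 / z` on `r₀ < |z| < R`: it is at most `1` on the inner circle and at
most `1/R` on the outer one. Nothing is assumed on `|z| = 1`, hence the limit `R → 1`. -/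
lemma norm_pow_ten_le_norm {r₀ : ℝ} (hr₀ : 0 < r₀) {c : ℝ} (hc : c < r₀) {ψ : ℂ → ℂ}
    (hd : DifferentiableOn ℂ ψ (unitAnnulus c)) (hb : ∀ z ∈ unitAnnulus c, ‖ψ z‖ < 1)
    (hmid : ∀ z : ℂ, ‖z‖ = r₀ → ‖ψ z‖ ^ 10 ≤ r₀) {z : ℂ} (hz : r₀ < ‖z‖) (hz1 : ‖z‖ < 1) :
    ‖ψ z‖ ^ 10 ≤ ‖z‖ := by
  have hzp : 0 < ‖z‖ := hr₀.trans hz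
  have key : ∀ R ∈ Ioo ‖z‖ 1, ‖ψ z‖ ^ 10 / ‖z‖ ≤ R⁻¹ := by
    intro R hR
    have hRp : 0 < R := hzp.trans hR.1
    set U : Set ℂ := {w | r₀ < ‖w‖ ∧ ‖w‖ < R} with hU
    have hUc : closure U ⊆ {w | r₀ ≤ ‖w‖ ∧ ‖w‖ ≤ R} :=
      closure_minimal (fun w hw => ⟨hw.1.le, hw.2.le⟩)
        ((isClosed_le continuous_const continuous_norm).inter
          (isClosed_le continuous_norm continuous_const))
    have hUo : IsOpen U := (isOpen_lt continuous_const continuous_norm).inter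
      (isOpen_lt continuous_norm continuous_const)
    have hUA : closure U ⊆ unitAnnulus c := fun w hw =>
      ⟨hc.trans_le (hUc hw).1, (hUc hw).2.trans_lt hR.2⟩
    have hdiff : DiffContOnCl ℂ (fun w => ψ w ^ 10 / w) U := by
      apply DifferentiableOn.diffContOnCl
      refine ((hd.mono hUA).pow 10).div differentiableOn_id fun w hw => ?_
      exact norm_pos_iff.1 (hr₀.trans_le (hUc hw).1)
    have hbd : Bornology.IsBounded U :=
      isBounded_ball.subset fun w hw => mem_ball_zero_iff.2 hw.2
    have := norm_le_of_forall_mem_frontier_norm_le hbd hdiff (C := R⁻¹) (fun w hw => ?_)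
      (subset_closure (show z ∈ U from ⟨hz, hR.1⟩))
    · rwa [norm_div, norm_pow] at this
    · rw [hUo.frontier_eq] at hw
      have hw1 := hUc hw.1
      rw [norm_div, norm_pow]
      rcases hw1.1.eq_or_lt with h | h
      · rw [← h]
        refine ((div_le_one hr₀).2 (hmid w h.symm)).trans ?_
        exact (one_le_inv₀ hRp).2 hR.2.le
      · have hwR : ‖w‖ = R := hw1.2.eq_of_not_lt fun h' => hw.2 ⟨h, h'⟩
        rw [hwR, div_eq_mul_inv]
        refine mul_le_of_le_one_left (by positivity) ?_
        exact pow_le_one₀ (norm_nonneg _) (hb w (hUA hw.1)).le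
  have hlim : Tendsto (fun R : ℝ => R⁻¹) (𝓝[<] 1) (𝓝 1) := by
    have : ContinuousAt (fun R : ℝ => R⁻¹) 1 := continuousAt_inv₀ one_ne_zero
    simpa using this.tendsto.mono_left nhdsWithin_le_nhds
  have := ge_of_tendsto hlim (Filter.mem_of_superset (Ioo_mem_nhdsLT hz1) key)
  rwa [div_le_one hzp] at this

lemma norm_pow_ten_le_of_antipodal {ψ : ℂ → ℂ} (hd : DifferentiableOn ℂ ψ (unitAnnulus 0.21))
    (hb : ∀ z ∈ unitAnnulus 0.21, ‖ψ z‖ < 1) (hodd : ψ (-(√0.21 : ℝ)) = -ψ (√0.21 : ℝ)) {z : ℂ}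
    (hz : √0.21 < ‖z‖) (hz1 : ‖z‖ < 1) : ‖ψ z‖ ^ 10 ≤ ‖z‖ := by
  have hs0 : (0 : ℝ) < √0.21 := by positivity
  have hsq : (√0.21 : ℝ) ^ 2 = 0.21 := Real.sq_sqrt (by norm_num)
  refine norm_pow_ten_le_norm hs0 (by nlinarith) hd hb (fun w hw => ?_) hz hz1
  -- The exponent `10` is the least natural number for which this numerical inequality holds.
  calc ‖ψ w‖ ^ 10 ≤ (23 / 25) ^ 10 :=
        pow_le_pow_left₀ (norm_nonneg _) (norm_le_of_antipodal hd hb hodd hw) 10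
    _ ≤ √0.21 := Real.le_sqrt_of_sq_le (by norm_num)

/-! ### The ratio and its Möbius normalisation -/

/-- The zeros of `g` are removable singularities of `f / g`: a pole of the normal form would force
its norm to infinity, against the bound `1`. -/
lemma exists_analytic_ratio {U : Set ℂ} (hU : IsOpen U) {f g : ℂ → ℂ} (hf : AnalyticOnNhd ℂ f U)
    (hg : AnalyticOnNhd ℂ g U) (hne : ∀ z ∈ U, ¬ ∀ᶠ w in 𝓝 z, g w = 0)
    (hfg : ∀ z ∈ U, ‖f z‖ ≤ ‖g z‖) :
    ∃ ω : ℂ → ℂ, DifferentiableOn ℂ ω U ∧ (∀ z ∈ U, ‖ω z‖ ≤ 1) ∧ ∀ z ∈ U, f z = ω z * g z := by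
  have hm : MeromorphicOn (f / g) U := fun z hz =>
    (hf z hz).meromorphicAt.div (hg z hz).meromorphicAt
  set ω := toMeromorphicNFOn (f / g) U with hω
  have heq : ∀ z ∈ U, ω =ᶠ[𝓝[≠] z] f / g := fun z hz =>
    hm.toMeromorphicNFOn_eq_self_on_nhdsNE hz
  have hle : ∀ z ∈ U, ∀ᶠ w in 𝓝[≠] z, ‖ω w‖ ≤ 1 := by
    intro z hz
    filter_upwards [heq z hz, nhdsWithin_le_nhds (hU.mem_nhds hz)] with w hw hwU
    rw [hw, Pi.div_apply, norm_div]
    exact div_le_one_of_le₀ (hfg w hwU) (norm_nonneg _)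
  have han : ∀ z ∈ U, AnalyticAt ℂ ω z := by
    intro z hz
    have hnf : MeromorphicNFAt ω z := meromorphicNFOn_toMeromorphicNFOn (f / g) U hz
    rw [← hnf.meromorphicOrderAt_nonneg_iff_analyticAt]
    by_contra! hneg
    have h1 := (tendsto_norm_atTop_iff_cobounded.2
      (tendsto_cobounded_of_meromorphicOrderAt_neg hneg)).eventually_gt_atTop 1
    obtain ⟨w, hw⟩ := (h1.and (hle z hz)).exists
    linarith [hw.1, hw.2]
  refine ⟨ω, fun z hz => (han z hz).differentiableAt.differentiableWithinAt, fun z hz => ?_,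
    fun z hz => ?_⟩
  · exact le_of_tendsto ((han z hz).continuousAt.norm.tendsto.mono_left nhdsWithin_le_nhds)
      (hle z hz)
  · have hg0 : ∀ᶠ w in 𝓝[≠] z, g w ≠ 0 :=
      (hg z hz).eventually_eq_zero_or_eventually_ne_zero.resolve_left (hne z hz)
    have h1 : f =ᶠ[𝓝[≠] z] fun w => ω w * g w := by
      filter_upwards [heq z hz, hg0] with w hw hw0
      rw [hw, Pi.div_apply, div_mul_cancel₀ _ hw0]
    have h2 : Tendsto f (𝓝[≠] z) (𝓝 (f z)) :=
      (hf z hz).continuousAt.tendsto.mono_left nhdsWithin_le_nhds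
    have h3 : Tendsto (fun w => ω w * g w) (𝓝[≠] z) (𝓝 (ω z * g z)) :=
      ((han z hz).continuousAt.mul (hg z hz).continuousAt).tendsto.mono_left nhdsWithin_le_nhds
    exact tendsto_nhds_unique (h2.congr' h1) h3

/-- Functions `f, g ∈ A²` with `f = ω g` in the annulus `c < |z| < 1`, where `|ω| < 1`. -/
structure IsContractivePair (c : ℝ) (f g ω : ℂ → ℂ) : Prop where
  diff_left : DifferentiableOn ℂ f (ball 0 1)
  diff_right : DifferentiableOn ℂ g (ball 0 1)
  memLp_left : MemLp f 2 (volume.restrict (ball 0 1))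
  memLp_right : MemLp g 2 (volume.restrict (ball 0 1))
  diff_ratio : DifferentiableOn ℂ ω (unitAnnulus c)
  ratio_lt : ∀ z ∈ unitAnnulus c, ‖ω z‖ < 1
  eq_mul : ∀ z ∈ unitAnnulus c, f z = ω z * g z

lemma IsContractivePair.mobius {c : ℝ} {f g ω : ℂ → ℂ} (h : IsContractivePair c f g ω) {a : ℂ}
    (ha : ‖a‖ < 1) :
    IsContractivePair c (fun z => f z - a * g z) (fun z => g z - conj a * f z)
      (fun z => (ω z - a) / (1 - conj a * ω z)) where
  diff_left := h.diff_left.sub (h.diff_right.const_mul a)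
  diff_right := h.diff_right.sub (h.diff_left.const_mul _)
  memLp_left := h.memLp_left.sub (h.memLp_right.const_mul a)
  memLp_right := h.memLp_right.sub (h.memLp_left.const_mul _)
  diff_ratio := (h.diff_ratio.sub_const _).div ((h.diff_ratio.const_mul _).const_sub _)
    fun z hz => one_sub_conj_mul_ne_zero ha (h.ratio_lt z hz).le
  ratio_lt z hz := norm_mobius_lt_one ha (h.ratio_lt z hz)
  eq_mul z hz := by
    have := one_sub_conj_mul_ne_zero ha (h.ratio_lt z hz).le
    rw [h.eq_mul z hz, div_mul_eq_mul_div, eq_div_iff this]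
    ring

/-- The cross terms cancel pointwise, so the difference of the squared norms is only scaled by `1 -
|a|² > 0`. Square integrability is what allows the subtraction. -/
lemma integral_norm_sq_mobius {c : ℝ} {f g ω : ℂ → ℂ} (h : IsContractivePair c f g ω) {a : ℂ}
    (ha : ‖a‖ < 1) (hle : ∫ z in ball (0 : ℂ) 1, ‖f z - a * g z‖ ^ 2 ≤
      ∫ z in ball (0 : ℂ) 1, ‖g z - conj a * f z‖ ^ 2) :
    ∫ z in ball (0 : ℂ) 1, ‖f z‖ ^ 2 ≤ ∫ z in ball (0 : ℂ) 1, ‖g z‖ ^ 2 := by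
  have i1 := h.memLp_left.integrable_norm_pow two_ne_zero
  have i2 := h.memLp_right.integrable_norm_pow two_ne_zero
  have i3 := (h.mobius ha).memLp_left.integrable_norm_pow two_ne_zero
  have i4 := (h.mobius ha).memLp_right.integrable_norm_pow two_ne_zero
  rw [← sub_nonneg, ← integral_sub i4 i3] at hle
  rw [← sub_nonneg, ← integral_sub i2 i1]
  have e : ∀ z, ‖g z - conj a * f z‖ ^ 2 - ‖f z - a * g z‖ ^ 2 =
      (1 - ‖a‖ ^ 2) * (‖g z‖ ^ 2 - ‖f z‖ ^ 2) := by
    intro z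
    simp only [← normSq_eq_norm_sq, normSq_apply, sub_re, sub_im, mul_re, mul_im, conj_re, conj_im]
    ring
  simp_rw [e] at hle
  rw [integral_const_mul] at hle
  exact nonneg_of_mul_nonneg_right hle (by nlinarith [norm_nonneg a])

/-! ### The inequality for a normalised pair -/

/-- On `S₂` the comparison is pointwise. On `S₃` the surplus of `|G|²` is at least `W |F|²`, whose
integral covers that of `|F|²` over `S₁`. -/
lemma lintegral_enorm_sq_le_of_antipodal {F G ψ : ℂ → ℂ} (h : IsContractivePair 0.21 F G ψ)
    (hodd : ψ (-(√0.21 : ℝ)) = -ψ (√0.21 : ℝ)) :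
    ∫⁻ z in ball (0 : ℂ) 1, ‖F z‖ₑ ^ 2 ≤ ∫⁻ z in ball (0 : ℂ) 1, ‖G z‖ₑ ^ 2 := by
  have hs0 : (0 : ℝ) < √0.21 := by positivity
  have hsq : (√0.21 : ℝ) ^ 2 = 0.21 := Real.sq_sqrt (by norm_num)
  have hcs : (0.21 : ℝ) < √0.21 := by nlinarith
  have hs1 : (√0.21 : ℝ) < 1 := by nlinarith
  set W : ℝ → ℝ≥0∞ := fun r => ENNReal.ofReal (r ^ (-(1 / 5) : ℝ) - 1) with hW
  have hWm : Measurable W := by fun_prop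
  set S₁ : Set ℂ := {z | ‖z‖ ≤ 0.21} with hS₁
  set S₂ : Set ℂ := {z | 0.21 < ‖z‖ ∧ ‖z‖ ≤ √0.21} with hS₂
  set S₃ : Set ℂ := {z | √0.21 < ‖z‖ ∧ ‖z‖ < 1} with hS₃
  have hm2 : MeasurableSet S₂ := (measurableSet_lt measurable_const measurable_norm).inter
    (measurableSet_le measurable_norm measurable_const)
  have hm3 : MeasurableSet S₃ := (measurableSet_lt measurable_const measurable_norm).inter
    (measurableSet_lt measurable_norm measurable_const)
  have hd23 : Disjoint S₂ S₃ := disjoint_left.2 fun z h2 h3 => absurd h2.2 (not_le.2 h3.1)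
  have hcover : ball (0 : ℂ) 1 ⊆ S₁ ∪ (S₂ ∪ S₃) := by
    intro z hz
    rw [mem_ball_zero_iff] at hz
    rcases le_or_gt ‖z‖ 0.21 with h1 | h1
    · exact Or.inl h1
    · rcases le_or_gt ‖z‖ √0.21 with h2 | h2
      · exact Or.inr (Or.inl ⟨h1, h2⟩)
      · exact Or.inr (Or.inr ⟨h2, hz⟩)
  have hsub : S₂ ∪ S₃ ⊆ ball (0 : ℂ) 1 := by
    rintro z (hz | hz)
    · exact mem_ball_zero_iff.2 (hz.2.trans_lt hs1)
    · exact mem_ball_zero_iff.2 hz.2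
  have hFG : ∀ z ∈ unitAnnulus 0.21, ‖F z‖ ≤ ‖G z‖ := fun z hz => by
    rw [h.eq_mul z hz, norm_mul]
    exact mul_le_of_le_one_left (norm_nonneg _) (h.ratio_lt z hz).le
  have hmid : ∫⁻ z in S₂, ‖F z‖ₑ ^ 2 ≤ ∫⁻ z in S₂, ‖G z‖ₑ ^ 2 := by
    refine setLIntegral_mono' hm2 fun z hz => ?_
    gcongr
    rw [enorm_le_iff_norm_le]
    exact hFG z ⟨hz.1, hz.2.trans_lt hs1⟩
  have hout : ∫⁻ z in S₃, (W ‖z‖ * ‖F z‖ₑ ^ 2 + ‖F z‖ₑ ^ 2) ≤ ∫⁻ z in S₃, ‖G z‖ₑ ^ 2 := by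
    refine setLIntegral_mono' hm3 fun z hz => ?_
    have hz0 : 0 < ‖z‖ := hs0.trans hz.1
    have hpow : 1 ≤ ‖z‖ ^ (-(1 / 5) : ℝ) :=
      Real.one_le_rpow_of_pos_of_le_one_of_nonpos hz0 hz.2.le (by norm_num)
    have hψ := norm_pow_ten_le_of_antipodal h.diff_ratio h.ratio_lt hodd hz.1 hz.2
    have hψ2 : ‖ψ z‖ ^ 2 ≤ ‖z‖ ^ (1 / 5 : ℝ) := by
      refine le_of_pow_le_pow_left₀ (n := 5) (by norm_num) (by positivity) ?_
      rw [← pow_mul, ← Real.rpow_natCast (‖z‖ ^ (1 / 5 : ℝ)), ← Real.rpow_mul hz0.le]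
      norm_num
      exact hψ
    have key : ‖z‖ ^ (-(1 / 5) : ℝ) * ‖F z‖ ^ 2 ≤ ‖G z‖ ^ 2 := by
      rw [h.eq_mul z ⟨hcs.trans hz.1, hz.2⟩, norm_mul, mul_pow, ← mul_assoc]
      refine mul_le_of_le_one_left (by positivity) ?_
      calc _ ≤ ‖z‖ ^ (-(1 / 5) : ℝ) * ‖z‖ ^ (1 / 5 : ℝ) := by gcongr
        _ = 1 := by rw [← Real.rpow_add hz0]; norm_num
    have e : ∀ H : ℂ → ℂ, ‖H z‖ₑ ^ 2 = ENNReal.ofReal (‖H z‖ ^ 2) := fun H => by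
      rw [ENNReal.ofReal_pow (norm_nonneg _), ofReal_norm]
    rw [e F, e G, hW, ← ENNReal.ofReal_mul (by linarith), ← ENNReal.ofReal_add
      (mul_nonneg (by linarith) (by positivity)) (by positivity)]
    exact ENNReal.ofReal_le_ofReal (by linarith)
  have hin := inner_mass_le_outer_mass (by norm_num) hcs hs1 W hWm lintegral_weight_le h.diff_left
  have hFm : AEMeasurable (fun z => ‖F z‖ₑ ^ 2) (volume.restrict S₃) := by
    have : AEMeasurable F (volume.restrict S₃) := by
      apply h.memLp_left.1.aemeasurable.mono_measure
      exact Measure.restrict_mono (subset_union_right.trans hsub) le_rfl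
    exact this.enorm.pow_const 2
  calc ∫⁻ z in ball (0 : ℂ) 1, ‖F z‖ₑ ^ 2
      ≤ ∫⁻ z in S₁ ∪ (S₂ ∪ S₃), ‖F z‖ₑ ^ 2 := lintegral_mono_set hcover
    _ ≤ (∫⁻ z in S₁, ‖F z‖ₑ ^ 2) + ∫⁻ z in S₂ ∪ S₃, ‖F z‖ₑ ^ 2 := lintegral_union_le _ _ _
    _ = (∫⁻ z in S₁, ‖F z‖ₑ ^ 2) + ((∫⁻ z in S₂, ‖F z‖ₑ ^ 2) + ∫⁻ z in S₃, ‖F z‖ₑ ^ 2) := by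
        rw [lintegral_union hm3 hd23]
    _ ≤ (∫⁻ z in S₃, W ‖z‖ * ‖F z‖ₑ ^ 2) +
        ((∫⁻ z in S₂, ‖G z‖ₑ ^ 2) + ∫⁻ z in S₃, ‖F z‖ₑ ^ 2) := by gcongr
    _ = (∫⁻ z in S₂, ‖G z‖ₑ ^ 2) + ∫⁻ z in S₃, (W ‖z‖ * ‖F z‖ₑ ^ 2 + ‖F z‖ₑ ^ 2) := by
        rw [lintegral_add_right' _ hFm]; ring
    _ ≤ (∫⁻ z in S₂, ‖G z‖ₑ ^ 2) + ∫⁻ z in S₃, ‖G z‖ₑ ^ 2 := by gcongr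
    _ = ∫⁻ z in S₂ ∪ S₃, ‖G z‖ₑ ^ 2 := (lintegral_union hm3 hd23).symm
    _ ≤ _ := lintegral_mono_set hsub

lemma ofReal_integral_norm_sq {f : ℂ → ℂ} (hf : MemLp f 2 (volume.restrict (ball 0 1))) :
    ENNReal.ofReal (∫ z in ball (0 : ℂ) 1, ‖f z‖ ^ 2) = ∫⁻ z in ball (0 : ℂ) 1, ‖f z‖ₑ ^ 2 := by
  rw [ofReal_integral_eq_lintegral_ofReal (hf.integrable_norm_pow two_ne_zero)
    (Eventually.of_forall fun z => by positivity)]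
  refine lintegral_congr fun z => ?_
  rw [ENNReal.ofReal_pow (norm_nonneg _), ofReal_norm]

lemma integral_norm_sq_le_of_antipodal {F G ψ : ℂ → ℂ} (h : IsContractivePair 0.21 F G ψ)
    (hodd : ψ (-(√0.21 : ℝ)) = -ψ (√0.21 : ℝ)) :
    ∫ z in ball (0 : ℂ) 1, ‖F z‖ ^ 2 ≤ ∫ z in ball (0 : ℂ) 1, ‖G z‖ ^ 2 := by
  have := lintegral_enorm_sq_le_of_antipodal h hodd
  rw [← ofReal_integral_norm_sq h.memLp_left, ← ofReal_integral_norm_sq h.memLp_right] at this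
  exact (ENNReal.ofReal_le_ofReal_iff (integral_nonneg fun z => by positivity)).1 this

/-! ### Reduction to the normalised pair -/

/-- The hyperbolic midpoint of `0` and `q`. -/
lemma exists_mobius_midpoint {q : ℂ} (hq : ‖q‖ < 1) :
    ∃ m : ℂ, ‖m‖ < 1 ∧ (q - m) / (1 - conj m * q) = m := by
  set k := √(1 - ‖q‖ ^ 2) with hk
  have hq2 : 0 < 1 - ‖q‖ ^ 2 := by nlinarith [norm_nonneg q]
  have hk0 : 0 < k := Real.sqrt_pos.2 hq2
  have hk2 : k ^ 2 = 1 - ‖q‖ ^ 2 := Real.sq_sqrt hq2.le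
  have hm : ‖q / ((1 + k : ℝ) : ℂ)‖ < 1 := by
    rw [norm_div, norm_real, Real.norm_of_nonneg (by positivity), div_lt_one (by positivity)]
    linarith
  refine ⟨q / ((1 + k : ℝ) : ℂ), hm, ?_⟩
  rw [div_eq_iff (one_sub_conj_mul_ne_zero hm hq.le)]
  have hne : ((1 + k : ℝ) : ℂ) ≠ 0 := by exact_mod_cast (by positivity : 1 + k ≠ 0)
  have hqq : conj q * q = 1 - (k : ℂ) ^ 2 := by
    rw [mul_comm, mul_conj, normSq_eq_norm_sq, ← ofReal_pow, hk2]
    push_cast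
    ring
  rw [map_div₀, conj_ofReal, div_mul_eq_mul_div (conj q), hqq]
  push_cast at hne ⊢
  field_simp
  ring

theorem IsContractivePair.integral_norm_sq_le {f g ω : ℂ → ℂ}
    (h : IsContractivePair 0.21 f g ω) :
    ∫ z in ball (0 : ℂ) 1, ‖f z‖ ^ 2 ≤ ∫ z in ball (0 : ℂ) 1, ‖g z‖ ^ 2 := by
  have hs0 : (0 : ℝ) < √0.21 := by positivity
  have hsq : (√0.21 : ℝ) ^ 2 = 0.21 := Real.sq_sqrt (by norm_num)
  have hp : ((√0.21 : ℝ) : ℂ) ∈ unitAnnulus 0.21 := by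
    constructor <;> rw [norm_real, Real.norm_of_nonneg hs0.le] <;> nlinarith
  have hn : -((√0.21 : ℝ) : ℂ) ∈ unitAnnulus 0.21 := by
    constructor <;> rw [norm_neg, norm_real, Real.norm_of_nonneg hs0.le] <;> nlinarith
  have ha := h.ratio_lt _ hp
  have h1 := h.mobius ha
  -- The first Möbius map has sent the value at `√0.21` to `0`. Recentring at the midpoint `m` sends
  -- it to `-m` and the value at `-√0.21` to `m`.
  obtain ⟨m, hm, hmeq⟩ := exists_mobius_midpoint (h1.ratio_lt _ hn)
  refine integral_norm_sq_mobius h ha (integral_norm_sq_mobius h1 hm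
    (integral_norm_sq_le_of_antipodal (h1.mobius hm) ?_))
  rw [hmeq]
  simp

/-! ### Finiteness and the general case -/

lemma memLp_of_lintegral_ne_top {f : ℂ → ℂ} (hf : ContinuousOn f (ball 0 1))
    (h : ∫⁻ z in ball (0 : ℂ) 1, ‖f z‖ₑ ^ 2 ≠ ∞) : MemLp f 2 (volume.restrict (ball 0 1)) := by
  refine ⟨hf.aestronglyMeasurable measurableSet_ball, ?_⟩
  rw [eLpNorm_lt_top_iff_lintegral_rpow_enorm_lt_top two_ne_zero ENNReal.ofNat_ne_top]
  simpa using h.lt_top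

lemma lintegral_ne_top_of_le_annulus {c : ℝ} (hc : c < 1) {f g : ℂ → ℂ}
    (hf : ContinuousOn f (ball 0 1)) (hfg : ∀ z ∈ unitAnnulus c, ‖f z‖ ≤ ‖g z‖)
    (hg : ∫⁻ z in ball (0 : ℂ) 1, ‖g z‖ₑ ^ 2 ≠ ∞) :
    ∫⁻ z in ball (0 : ℂ) 1, ‖f z‖ₑ ^ 2 ≠ ∞ := by
  obtain ⟨C, hC⟩ := (isCompact_closedBall (0 : ℂ) c).exists_bound_of_continuousOn
    (hf.mono (closedBall_subset_ball hc))
  have hcover : ball (0 : ℂ) 1 ⊆ closedBall 0 c ∪ unitAnnulus c := by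
    intro z hz
    rcases le_or_gt ‖z‖ c with h1 | h1
    · exact Or.inl (mem_closedBall_zero_iff.2 h1)
    · exact Or.inr ⟨h1, mem_ball_zero_iff.1 hz⟩
  refine ne_top_of_le_ne_top ?_ ((lintegral_mono_set hcover).trans (lintegral_union_le _ _ _))
  refine ENNReal.add_ne_top.2 ⟨?_, ?_⟩
  · refine ne_top_of_le_ne_top (b := ∫⁻ z in closedBall (0 : ℂ) c, ENNReal.ofReal C ^ 2) ?_
      (setLIntegral_mono' measurableSet_closedBall fun z hz => ?_)
    · rw [setLIntegral_const]
      exact ENNReal.mul_ne_top (by finiteness) measure_closedBall_lt_top.ne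
    · gcongr
      rw [← ofReal_norm]
      exact ENNReal.ofReal_le_ofReal (hC z hz)
  · refine ne_top_of_le_ne_top hg ?_
    calc _ ≤ ∫⁻ z in unitAnnulus c, ‖g z‖ₑ ^ 2 := by
          refine setLIntegral_mono' (isOpen_unitAnnulus c).measurableSet fun z hz => ?_
          gcongr
          rw [enorm_le_iff_norm_le]
          exact hfg z hz
      _ ≤ _ := lintegral_mono_set fun z hz => mem_ball_zero_iff.2 hz.2

theorem lintegral_enorm_sq_le_of_norm_le_on_annulus {f g : ℂ → ℂ}
    (hf : AnalyticOnNhd ℂ f (ball (0 : ℂ) 1)) (hg : AnalyticOnNhd ℂ g (ball (0 : ℂ) 1))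
    (hfg : ∀ z ∈ unitAnnulus 0.21, ‖f z‖ ≤ ‖g z‖) :
    ∫⁻ z in ball (0 : ℂ) 1, ‖f z‖ₑ ^ 2 ≤ ∫⁻ z in ball (0 : ℂ) 1, ‖g z‖ₑ ^ 2 := by
  rcases eq_or_ne (∫⁻ z in ball (0 : ℂ) 1, ‖g z‖ₑ ^ 2) ∞ with htop | htop
  · rw [htop]; exact le_top
  have hAb : unitAnnulus 0.21 ⊆ ball (0 : ℂ) 1 := fun z hz => mem_ball_zero_iff.2 hz.2
  have hpre : IsPreconnected (ball (0 : ℂ) 1) := (convex_ball _ _).isPreconnected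
  by_cases hz : ∃ z ∈ unitAnnulus 0.21, ∀ᶠ w in 𝓝 z, g w = 0
  -- If `g` vanishes near a point of the annulus, so does `f`, and the identity theorem makes `f`
  -- zero on the disk.
  · obtain ⟨z, hz, hgz⟩ := hz
    have hfz : f =ᶠ[𝓝 z] 0 := by
      filter_upwards [hgz, (isOpen_unitAnnulus 0.21).mem_nhds hz] with w hw hwA
      have := hfg w hwA
      rw [hw, norm_zero] at this
      exact norm_le_zero_iff.1 this
    have hf0 := hf.eqOn_zero_of_preconnected_of_eventuallyEq_zero hpre (hAb hz) hfz
    rw [setLIntegral_congr_fun measurableSet_ball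
      (g := fun _ => 0) fun w hw => by simp [hf0 hw]]
    simp
  push Not at hz
  obtain ⟨ω, hωd, hω1, hω⟩ := exists_analytic_ratio (isOpen_unitAnnulus 0.21) (hf.mono hAb)
    (hg.mono hAb) (fun z hzA hev => (hz z hzA).and_eventually hev |>.exists.elim
      fun w hw => hw.1 hw.2) hfg
  have hgm := memLp_of_lintegral_ne_top hg.continuousOn htop
  have hfm := memLp_of_lintegral_ne_top hf.continuousOn
    (lintegral_ne_top_of_le_annulus (by norm_num) hf.continuousOn hfg htop)
  -- The factor `t < 1` turns `|ω| ≤ 1` into the strict bound that the Möbius maps need; it is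
  -- removed by letting `t → 1`.
  have key : ∀ t ∈ Ioo (0 : ℝ) 1, t ^ 2 * ∫ z in ball (0 : ℂ) 1, ‖f z‖ ^ 2 ≤
      ∫ z in ball (0 : ℂ) 1, ‖g z‖ ^ 2 := by
    intro t ht
    have hpair : IsContractivePair 0.21 (fun z => t * f z) g (fun z => t * ω z) :=
      { diff_left := hf.differentiableOn.const_mul _
        diff_right := hg.differentiableOn
        memLp_left := hfm.const_mul _
        memLp_right := hgm
        diff_ratio := hωd.const_mul _
        ratio_lt := fun z hz => by
          rw [norm_mul, norm_real, Real.norm_of_nonneg ht.1.le]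
          nlinarith [hω1 z hz, ht.1, ht.2]
        eq_mul := fun z hz => by simp only [hω z hz]; ring }
    have := hpair.integral_norm_sq_le
    simp only [norm_mul, norm_real, Real.norm_of_nonneg ht.1.le, mul_pow] at this
    rwa [integral_const_mul] at this
  rw [← ofReal_integral_norm_sq hfm, ← ofReal_integral_norm_sq hgm]
  apply ENNReal.ofReal_le_ofReal
  have hlim : Tendsto (fun t : ℝ => t ^ 2 * ∫ z in ball (0 : ℂ) 1, ‖f z‖ ^ 2) (𝓝[<] 1)
      (𝓝 (1 ^ 2 * ∫ z in ball (0 : ℂ) 1, ‖f z‖ ^ 2)) :=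
    (Continuous.tendsto (by fun_prop) 1).mono_left nhdsWithin_le_nhds
  rw [one_pow, one_mul] at hlim
  exact le_of_tendsto hlim (Filter.mem_of_superset (Ioo_mem_nhdsLT zero_lt_one) key)

theorem theorem1 (f g : ℂ → ℂ)
    (hf : AnalyticOnNhd ℂ f (Metric.ball (0 : ℂ) 1))
    (hg : AnalyticOnNhd ℂ g (Metric.ball (0 : ℂ) 1))
    (hfg : ∀ z : ℂ, (0.21 : ℝ) < ‖z‖ → ‖z‖ < 1 → ‖f z‖ ≤ ‖g z‖) :
    bergmanNorm f ≤ bergmanNorm g := by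
  unfold bergmanNorm
  have := lintegral_enorm_sq_le_of_norm_le_on_annulus hf hg fun z hz => hfg z hz.1 hz.2
  gcongr
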